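/- Let $k$ be a field of characteristic $p>0$, let $n\ge 0$, let $R=k[x_1,\dots,x_n]$ with its standard grading, and let $\mathfrak m=(x_1,\dots,x_n)$. For an $R$-module $M$ let $F(M)=R'\otimes_R M$, where $R'$ is a copy of $R$ viewed as an $R$-algebra through the Frobenius map $r\mapsto r^p$ and $F(M)$ is an $R$-module through the factor $R'$; if $M=\bigoplus_{d\in\mathbb Z}M_d$ is a graded $R$-module, then $F(M)$ is graded by $\deg(r\otimes x)=\deg r+p\deg x$ for homogeneous $r$ and $x$. A graded $F$-module is a graded $R$-module $M$ together with a degree preserving $R$-linear isomorphism $\theta:M\to F(M)$. A graded $R$-module is $^*$injective if it is an injective object of the category of graded $R$-modules and degree preserving $R$-linear maps. Let $^*E(R/\mathfrak m)$ be the $^*$injective hull of $R/\mathfrak m$, that is, a $^*$injective graded module containing $R/\mathfrak m$ as a graded submodule that meets every nonzero graded submodule nontrivially. For a graded module $N$ and $t\in\mathbb Z$ let $N(t)$ be the shifted module with $N(t)_d=N_{t+d}$. **Theorem.** Let $(M,\theta)$ be a graded $F$-module over $R$ whose support has dimension at most $0$ (so $M=0$ is allowed). Then $M$ is a $^*$injective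 $R$-module. Moreover, $M$ is the direct sum of a (possibly infinite, possibly empty) family of graded submodules $M_i$ such that each $M_i$ is isomorphic, as a graded $R$-module, to $^*E(R/\mathfrak m)(t_i)$ for some $t_i\in\mathbb Z$. -/

import Mathlib

universe u v v' w

open scoped TensorProduct

/-! ### The Frobenius functor -/

/-- The second copy `R'` of a ring `R`, the target of the Frobenius homomorphism `R → R'`. -/
def FrobeniusCopy (_p : ℕ) (R : Type u) : Type u := R

instance FrobeniusCopy.instCommRing (p : ℕ) (R : Type u) [CommRing R] :
    CommRing (FrobeniusCopy p R) :=
  inferInstanceAs (CommRing R)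

/-- The identity map, seen as a ring isomorphism from `R` to its copy `R'`. -/
def FrobeniusCopy.of (p : ℕ) (R : Type u) [CommRing R] : R ≃+* FrobeniusCopy p R :=
  RingEquiv.refl R

/-- `R'` is an `R`-algebra by the Frobenius homomorphism `r ↦ r ^ p`. -/
instance FrobeniusCopy.instAlgebra (p : ℕ) [Fact p.Prime] (R : Type u) [CommRing R] [CharP R p] :
    Algebra R (FrobeniusCopy p R) :=
  ((FrobeniusCopy.of p R).toRingHom.comp (frobenius R p)).toAlgebra

/-- The value `F(M) = R' ⊗_R M` of the Frobenius functor. -/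
def FrobeniusPullback (p : ℕ) [Fact p.Prime] (R : Type u) [CommRing R] [CharP R p]
    (M : Type v) [AddCommGroup M] [Module R M] : Type (max u v) :=
  FrobeniusCopy p R ⊗[R] M

section FrobeniusPullback

variable (p : ℕ) [Fact p.Prime] (R : Type u) [CommRing R] [CharP R p]
  (M : Type v) [AddCommGroup M] [Module R M]

noncomputable instance FrobeniusPullback.instAddCommGroup :
    AddCommGroup (FrobeniusPullback p R M) :=
  inferInstanceAs (AddCommGroup (FrobeniusCopy p R ⊗[R] M))

noncomputable instance FrobeniusPullback.instModuleCopy :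
    Module (FrobeniusCopy p R) (FrobeniusPullback p R M) :=
  inferInstanceAs (Module (FrobeniusCopy p R) (FrobeniusCopy p R ⊗[R] M))

/-- `F(M)` is an `R`-module by multiplication on the factor `R'`, that is
`r • (s ⊗ x) = (r * s) ⊗ x`. -/
noncomputable instance FrobeniusPullback.instModule : Module R (FrobeniusPullback p R M) :=
  Module.compHom _ (FrobeniusCopy.of p R).toRingHom

variable {R M}

/-- The element `r ⊗ x` of `F(M)`. -/
noncomputable def FrobeniusPullback.tmul (r : R) (x : M) : FrobeniusPullback p R M :=
  FrobeniusCopy.of p R r ⊗ₜ[R] x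

theorem FrobeniusPullback.smul_tmul (r s : R) (x : M) :
    r • FrobeniusPullback.tmul p s x = FrobeniusPullback.tmul p (r * s) x :=
  rfl

theorem FrobeniusPullback.tmul_smul (r s : R) (x : M) :
    FrobeniusPullback.tmul p r (s • x) = FrobeniusPullback.tmul p (r * s ^ p) x := by
  have h := TensorProduct.smul_tmul (R := R) s (FrobeniusCopy.of p R r) x
  refine h.symm.trans ?_
  rw [Algebra.smul_def, mul_comm]
  rfl

end FrobeniusPullback

/-! ### Graded modules over the polynomial ring `R = k[x_1, …, x_n]` -/

section Graded

variable (k : Type u) [Field k] (n : ℕ)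
  {M : Type v} [AddCommGroup M] [Module (MvPolynomial (Fin n) k) M]

/-- The family `𝓜` of subgroups is a grading of the `R`-module `M`, where `R` has its standard
grading: `M = ⨁ 𝓜 d` and `R_i 𝓜_j ⊆ 𝓜_{i + j}` (`R_i = 0` for `i < 0`). -/
structure IsGradedModule (𝓜 : ℤ → AddSubgroup M) : Prop where
  isInternal : DirectSum.IsInternal 𝓜
  smul_mem : ∀ (i : ℕ) (j : ℤ) (r : MvPolynomial (Fin n) k) (x : M),
    r ∈ MvPolynomial.homogeneousSubmodule (Fin n) k i → x ∈ 𝓜 j → r • x ∈ 𝓜 (i + j)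

/-- Degree preserving maps: `f (M_d) ⊆ N_d` for all `d`. -/
def IsDegreePreserving {N : Type w} [AddCommGroup N] [Module (MvPolynomial (Fin n) k) N]
    (𝓜 : ℤ → AddSubgroup M) (𝓝 : ℤ → AddSubgroup N)
    (f : M →ₗ[MvPolynomial (Fin n) k] N) : Prop :=
  ∀ (d : ℤ) (x : M), x ∈ 𝓜 d → f x ∈ 𝓝 d

/-- The shifted grading `M(t)_d = M_{t + d}`. -/
def shiftGrading {M : Type v} [AddCommGroup M] (𝓜 : ℤ → AddSubgroup M) (t : ℤ) :
    ℤ → AddSubgroup M :=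
  fun d => 𝓜 (t + d)

/-- The family `M_d ∩ U` of subgroups of a submodule `U`. -/
noncomputable def inducedGrading (𝓜 : ℤ → AddSubgroup M)
    (U : Submodule (MvPolynomial (Fin n) k) M) :
    ℤ → AddSubgroup U :=
  fun d => (𝓜 d).comap U.subtype.toAddMonoidHom

/-- A submodule `U` is graded if `U = ⨁ (M_d ∩ U)`. -/
def IsGradedSubmodule (𝓜 : ℤ → AddSubgroup M)
    (U : Submodule (MvPolynomial (Fin n) k) M) : Prop :=
  IsGradedModule k n (inducedGrading k n 𝓜 U)

/-- `*injective` modules: the injective objects of the category of graded `R`-modules and degree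
preserving `R`-linear maps. -/
def IsStarInjective (𝓜 : ℤ → AddSubgroup M) : Prop :=
  ∀ (A B : Type w) [AddCommGroup A] [Module (MvPolynomial (Fin n) k) A]
    [AddCommGroup B] [Module (MvPolynomial (Fin n) k) B]
    (𝓐 : ℤ → AddSubgroup A) (𝓑 : ℤ → AddSubgroup B),
    IsGradedModule k n 𝓐 → IsGradedModule k n 𝓑 →
    ∀ (f : A →ₗ[MvPolynomial (Fin n) k] B) (g : A →ₗ[MvPolynomial (Fin n) k] M),
      IsDegreePreserving k n 𝓐 𝓑 f → Function.Injective f → IsDegreePreserving k n 𝓐 𝓜 g →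
      ∃ h : B →ₗ[MvPolynomial (Fin n) k] M, IsDegreePreserving k n 𝓑 𝓜 h ∧ h ∘ₗ f = g

/-- The maximal homogeneous ideal `𝔪 = (x_1, …, x_n)`. -/
noncomputable def irrelevantIdeal : Ideal (MvPolynomial (Fin n) k) :=
  Ideal.span (Set.range MvPolynomial.X)

/-- The standard grading of `R`, extended by `0` to negative degrees. -/
noncomputable def polyGrading (d : ℤ) : AddSubgroup (MvPolynomial (Fin n) k) :=
  if 0 ≤ d then (MvPolynomial.homogeneousSubmodule (Fin n) k d.toNat).toAddSubgroup else ⊥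

/-- The grading of `R/𝔪` induced from `R`. -/
noncomputable def residueGrading (d : ℤ) :
    AddSubgroup (MvPolynomial (Fin n) k ⧸ irrelevantIdeal k n) :=
  (polyGrading k n d).map (Ideal.Quotient.mk (irrelevantIdeal k n)).toAddMonoidHom

/-- The module `E` with the grading `𝓔` is a `*injective` hull of `N` with the grading `𝓝`:
it is a graded module, it is `*injective`, and it is a `*essential` extension of `N`, that is, `N`
embeds into `E` by a degree preserving map whose image meets every nonzero graded submodule of `E`
nontrivially. -/
def IsStarInjectiveHull {N : Type v} [AddCommGroup N] [Module (MvPolynomial (Fin n) k) N]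
    {E : Type v'} [AddCommGroup E] [Module (MvPolynomial (Fin n) k) E]
    (𝓝 : ℤ → AddSubgroup N) (𝓔 : ℤ → AddSubgroup E) : Prop :=
  IsGradedModule k n 𝓔 ∧ IsStarInjective.{u, v', w} k n 𝓔 ∧
    ∃ j : N →ₗ[MvPolynomial (Fin n) k] E,
      IsDegreePreserving k n 𝓝 𝓔 j ∧ Function.Injective j ∧
      ∀ U : Submodule (MvPolynomial (Fin n) k) E,
        IsGradedSubmodule k n 𝓔 U → U ≠ ⊥ → U ⊓ LinearMap.range j ≠ ⊥

/-- `M` is isomorphic, as a graded module, to the shift `*E(R/𝔪)(t)` of the `*injective` hull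
`*E(R/𝔪)`. A `*injective` hull is only determined up to degree preserving isomorphism, so this
means that `M(-t)` is a `*injective` hull of `R/𝔪`. -/
def IsStarEShift (𝓜 : ℤ → AddSubgroup M) (t : ℤ) : Prop :=
  IsStarInjectiveHull.{u, u, v, w} k n (residueGrading k n) (shiftGrading 𝓜 (-t))

variable (p : ℕ) [Fact p.Prime] [CharP k p]

/-- The grading of `F(M)`: the part of degree `d` is generated by the elements `r ⊗ x` with
`r` and `x` homogeneous and `deg r + p * deg x = d`. -/
noncomputable def frobeniusGrading (𝓜 : ℤ → AddSubgroup M) (d : ℤ) :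
    AddSubgroup (FrobeniusPullback p (MvPolynomial (Fin n) k) M) :=
  AddSubgroup.closure
    {z | ∃ (i : ℕ) (j : ℤ) (r : MvPolynomial (Fin n) k) (x : M),
      r ∈ MvPolynomial.homogeneousSubmodule (Fin n) k i ∧ x ∈ 𝓜 j ∧ (i : ℤ) + p * j = d ∧
      z = FrobeniusPullback.tmul p r x}

/-- `(M, θ)` with the grading `𝓜` is a graded `F`-module; the `F`-module structure is the
`R`-linear isomorphism `θ : M ≃ F(M)`. -/
structure IsGradedFModule (𝓜 : ℤ → AddSubgroup M)
    (θ : M ≃ₗ[MvPolynomial (Fin n) k] FrobeniusPullback p (MvPolynomial (Fin n) k) M) : Prop where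
  isGradedModule : IsGradedModule k n 𝓜
  isDegreePreserving : IsDegreePreserving k n 𝓜 (frobeniusGrading k n p 𝓜) θ.toLinearMap

end Graded

/-!
Write `c = -n`. The proof shows that `M` is coinduced from its part of degree `c`: for every `d`,
multiplication identifies `M_d` with `Hom_k (R_{c-d}, M_c)`. This is the predicate `IsCoinduced`.

A coinduced module is `*injective` (`IsCoinduced.isStarInjective`), because degree preserving maps
to it correspond to `k`-linear maps to `M_c`, and those extend from a subspace to the whole space.
A `k`-basis of `M_c` splits a coinduced module into coinduced modules with a one-dimensional part of
degree `c`, and such a module is a `*injective` hull of `R/𝔪` up to a shift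
(`IsCoinduced.exists_decomposition`).

It remains to see that `M` is coinduced (`IsGradedFModule.isCoinduced`).

* Since the support has dimension `≤ 0`, the annihilator of a homogeneous element contains a power
  of each variable (`IsGradedModule.exists_X_pow_smul_eq_zero`), so every nonzero homogeneous element
  has a nonzero multiple in the socle of `M`, the elements killed by all variables.
* `R'` is a free `R`-module with basis `λ X ^ r`, where `λ` runs through a basis of `k` over its
  subfield of `p`-th powers and `r` through `{0, …, p - 1} ^ n`. In these coordinates, the socle of
  `F(M)` is seen to consist of the sums of elements `λ X ^ (p - 1, …, p - 1) ⊗ s` with `s` in the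
  socle of `M`.
* Comparing degrees under `θ`, if the socle of `M` is nonzero in degree `d`, then it is nonzero in a
  degree `e` with `d + n = p (e + n)`. By descent, the socle lies in degree `-n`
  (`IsGradedFModule.degree_eq_of_socle`). This makes `M_d → Hom_k (R_{c-d}, M_c)` injective.
* Surjectivity asks for solutions `y` of `X ^ a • y = s` that are killed by the other monomials of
  the same degree. For `a = p q + r` with `r ∈ {0, …, p - 1} ^ n`, write `θ s` as a sum of elements
  `λ X ^ (p - 1, …, p - 1) ⊗ s'`; if `y'` solves the problem for `q` and `s'`, then
  `λ X ^ (p - 1 - r) ⊗ y'` solves it for `a` and that summand (`exists_dual_of_socle`).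
-/

open MvPolynomial

/-! ### Graded modules and their homogeneous components -/

section GradedModule

variable {k : Type u} [Field k] {n : ℕ}
  {M : Type v} [AddCommGroup M] [Module (MvPolynomial (Fin n) k) M] {𝓜 : ℤ → AddSubgroup M}

/-- The projection `x ↦ x_d` of a graded module onto its part of degree `d`, as an additive
endomorphism of the module. -/
noncomputable def IsGradedModule.proj (hM : IsGradedModule k n 𝓜) (d : ℤ) : M →+ M :=
  letI := hM.isInternal.chooseDecomposition
  { toFun := fun x => (DirectSum.decompose 𝓜 x d : M)
    map_zero' := by simp
    map_add' := by simp }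

theorem IsGradedModule.proj_mem (hM : IsGradedModule k n 𝓜) (d : ℤ) (x : M) :
    hM.proj d x ∈ 𝓜 d :=
  let := hM.isInternal.chooseDecomposition
  (DirectSum.decompose 𝓜 x d).2

theorem IsGradedModule.proj_of_mem (hM : IsGradedModule k n 𝓜) {d : ℤ} {x : M} (hx : x ∈ 𝓜 d) :
    hM.proj d x = x :=
  let := hM.isInternal.chooseDecomposition
  DirectSum.decompose_of_mem_same 𝓜 hx

theorem IsGradedModule.proj_of_mem_of_ne (hM : IsGradedModule k n 𝓜) {d e : ℤ} {x : M}
    (hx : x ∈ 𝓜 d) (hde : d ≠ e) : hM.proj e x = 0 :=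
  let := hM.isInternal.chooseDecomposition
  DirectSum.decompose_of_mem_ne 𝓜 hx hde

theorem IsGradedModule.exists_sum_proj (hM : IsGradedModule k n 𝓜) (x : M) :
    ∃ s : Finset ℤ, x = ∑ d ∈ s, hM.proj d x := by
  classical
  let := hM.isInternal.chooseDecomposition
  exact ⟨_, (DirectSum.sum_support_decompose 𝓜 x).symm⟩

theorem IsGradedModule.eq_zero_of_proj (hM : IsGradedModule k n 𝓜) {x : M}
    (hx : ∀ d, hM.proj d x = 0) : x = 0 := by
  obtain ⟨s, hs⟩ := hM.exists_sum_proj x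
  rw [hs]
  exact Finset.sum_eq_zero fun d _ => hx d

theorem IsGradedModule.induction (hM : IsGradedModule k n 𝓜) {motive : M → Prop}
    (zero : motive 0) (homogeneous : ∀ d x, x ∈ 𝓜 d → motive x)
    (add : ∀ x y, motive x → motive y → motive (x + y)) (x : M) : motive x := by
  obtain ⟨s, hs⟩ := hM.exists_sum_proj x
  rw [hs]
  exact Finset.sum_induction _ motive add zero fun d _ => homogeneous d _ (hM.proj_mem d x)

theorem IsGradedModule.proj_smul (hM : IsGradedModule k n 𝓜) {i : ℕ}
    {r : MvPolynomial (Fin n) k} (hr : r.IsHomogeneous i) (d : ℤ) (x : M) :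
    hM.proj (i + d) (r • x) = r • hM.proj d x := by
  induction x using hM.induction with
  | zero => simp
  | add x y hx hy => simp [hx, hy]
  | homogeneous e x hx =>
    have hrx := hM.smul_mem i e r x hr hx
    by_cases h : e = d
    · subst h
      rw [hM.proj_of_mem hrx, hM.proj_of_mem hx]
    · rw [hM.proj_of_mem_of_ne hrx (by omega), hM.proj_of_mem_of_ne hx h, smul_zero]

theorem IsGradedModule.proj_C_smul (hM : IsGradedModule k n 𝓜) (a : k) (d : ℤ) (x : M) :
    hM.proj d ((C a : MvPolynomial (Fin n) k) • x) =
      (C a : MvPolynomial (Fin n) k) • hM.proj d x := by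
  simpa using hM.proj_smul (isHomogeneous_C (Fin n) a) d x

theorem IsGradedModule.C_smul_mem (hM : IsGradedModule k n 𝓜) (a : k) {d : ℤ} {x : M}
    (hx : x ∈ 𝓜 d) : (C a : MvPolynomial (Fin n) k) • x ∈ 𝓜 d := by
  simpa using hM.smul_mem 0 d _ x (isHomogeneous_C (Fin n) a) hx

theorem IsGradedModule.monomial_smul_mem (hM : IsGradedModule k n 𝓜) (a : Fin n →₀ ℕ) {d : ℤ}
    {x : M} (hx : x ∈ 𝓜 d) : monomial a (1 : k) • x ∈ 𝓜 (a.degree + d) :=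
  hM.smul_mem _ d _ x (isHomogeneous_monomial (1 : k) rfl) hx

theorem IsGradedModule.proj_map (hM : IsGradedModule k n 𝓜)
    {N : Type w} [AddCommGroup N] [Module (MvPolynomial (Fin n) k) N] {𝓝 : ℤ → AddSubgroup N}
    (hN : IsGradedModule k n 𝓝) {f : M →ₗ[MvPolynomial (Fin n) k] N}
    (hf : IsDegreePreserving k n 𝓜 𝓝 f) (d : ℤ) (x : M) :
    hN.proj d (f x) = f (hM.proj d x) := by
  induction x using hM.induction with
  | zero => simp
  | add x y hx hy => simp [hx, hy]
  | homogeneous e x hx =>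
    by_cases h : e = d
    · subst h
      rw [hN.proj_of_mem (hf _ _ hx), hM.proj_of_mem hx]
    · rw [hN.proj_of_mem_of_ne (hf _ _ hx) h, hM.proj_of_mem_of_ne hx h, map_zero]

/-- A family of subgroups is a grading as soon as it spans and admits a family of projections. -/
theorem isInternal_of_projections {U : Type v} [AddCommGroup U] {𝓤 : ℤ → AddSubgroup U}
    (π : ℤ → U →+ U) (h_same : ∀ d x, x ∈ 𝓤 d → π d x = x)
    (h_ne : ∀ d e x, x ∈ 𝓤 d → d ≠ e → π e x = 0) (h_span : ∀ x, x ∈ ⨆ d, 𝓤 d) :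
    DirectSum.IsInternal 𝓤 := by
  classical
  have key : ∀ (z : DirectSum ℤ fun d => 𝓤 d) (d : ℤ),
      π d (DirectSum.coeAddMonoidHom 𝓤 z) = z d := by
    intro z d
    induction z using DirectSum.induction_on with
    | zero => simp
    | add x y hx hy => simp [hx, hy]
    | of e x =>
      rw [DirectSum.coeAddMonoidHom_of]
      by_cases h : e = d
      · subst h
        rw [h_same _ _ x.2, DirectSum.of_eq_same]
      · rw [h_ne _ _ _ x.2 h, DirectSum.of_eq_of_ne _ _ _ (Ne.symm h), AddSubgroup.coe_zero]
  refine ⟨(injective_iff_map_eq_zero _).2 fun z hz => ?_, fun x => ?_⟩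
  · ext d
    rw [← key z d, hz, map_zero]
    rfl
  · refine AddSubgroup.iSup_induction (C := fun x => ∃ z, DirectSum.coeAddMonoidHom 𝓤 z = x) 𝓤
      (h_span x) (fun d x hx => ⟨DirectSum.of (fun d => 𝓤 d) d ⟨x, hx⟩, ?_⟩) ⟨0, map_zero _⟩ ?_
    · exact DirectSum.coeAddMonoidHom_of _ _ _
    · rintro _ _ ⟨x, rfl⟩ ⟨y, rfl⟩
      exact ⟨x + y, map_add _ _ _⟩

theorem IsGradedModule.shiftGrading (hM : IsGradedModule k n 𝓜) (t : ℤ) :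
    IsGradedModule k n (shiftGrading 𝓜 t) := by
  refine ⟨isInternal_of_projections (fun d => hM.proj (t + d))
    (fun d x hx => hM.proj_of_mem hx)
    (fun d e x hx hde => hM.proj_of_mem_of_ne hx (by omega)) fun x => ?_, ?_⟩
  · induction x using hM.induction with
    | zero => exact zero_mem _
    | add x y hx hy => exact add_mem hx hy
    | homogeneous d x hx =>
      refine AddSubgroup.mem_iSup_of_mem (d - t) ?_
      change x ∈ 𝓜 (t + (d - t))
      rwa [add_sub_cancel]
  · intro i j r x hr hx
    change r • x ∈ 𝓜 (t + (i + j))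
    rw [add_left_comm]
    exact hM.smul_mem i _ r x hr hx

/-- A submodule that contains the homogeneous components of its elements is graded. -/
theorem IsGradedModule.isGradedSubmodule (hM : IsGradedModule k n 𝓜)
    {U : Submodule (MvPolynomial (Fin n) k) M} (hU : ∀ d, ∀ x ∈ U, hM.proj d x ∈ U) :
    IsGradedSubmodule k n 𝓜 U := by
  refine ⟨isInternal_of_projections
    (fun d => ((hM.proj d).comp U.subtype.toAddMonoidHom).codRestrict U fun x => hU d x x.2)
    (fun d x hx => Subtype.ext (hM.proj_of_mem hx))
    (fun d e x hx hde => Subtype.ext (hM.proj_of_mem_of_ne hx hde)) fun x => ?_,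
    fun i j r x hr hx => hM.smul_mem i j r x hr hx⟩
  obtain ⟨s, hs⟩ := hM.exists_sum_proj (x : M)
  have hx : x = ∑ d ∈ s, ⟨hM.proj d x, hU d x x.2⟩ := Subtype.ext (by simpa using hs)
  rw [hx]
  exact sum_mem fun d _ => AddSubgroup.mem_iSup_of_mem d (hM.proj_mem d _)

end GradedModule

/-! ### Coinduced modules are `*injective` -/

section Coinduced

variable {k : Type u} [Field k] {n : ℕ}
  {M : Type v} [AddCommGroup M] [Module (MvPolynomial (Fin n) k) M] {𝓜 : ℤ → AddSubgroup M}

variable (k n) in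
/-- The graded module `M` is coinduced from its part of degree `c`: for every `d`, the map
`x ↦ (r ↦ r • x)` from `M_d` to `Hom_k (R_{c-d}, M_c)` is bijective (where `R_{c-d} = 0` if
`c < d`). Surjectivity is expressed in the basis of `R_{c-d}` formed by the monomials: for each
monomial `X ^ a` and each `s ∈ M_c`, some `y` is sent to the map with value `s` at `X ^ a` and `0`
at the other monomials of the same degree. -/
structure IsCoinduced (𝓜 : ℤ → AddSubgroup M) (c : ℤ) : Prop where
  eq_zero : ∀ (d : ℤ) (x : M), x ∈ 𝓜 d →
    (∀ a : Fin n →₀ ℕ, a.degree + d = c → monomial a (1 : k) • x = 0) → x = 0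
  exists_dual : ∀ (a : Fin n →₀ ℕ) (s : M), s ∈ 𝓜 c → ∃ y ∈ 𝓜 (c - a.degree),
    monomial a (1 : k) • y = s ∧
      ∀ b : Fin n →₀ ℕ, b.degree = a.degree → b ≠ a → monomial b (1 : k) • y = 0

theorem IsCoinduced.shiftGrading {c : ℤ} (h : IsCoinduced k n 𝓜 c) (t : ℤ) :
    IsCoinduced k n (shiftGrading 𝓜 t) (c - t) where
  eq_zero d x hx ha := h.eq_zero (t + d) x hx fun a had => ha a (by omega)
  exists_dual a s hs := by
    have hs' : s ∈ 𝓜 c := by simpa [_root_.shiftGrading] using hs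
    obtain ⟨y, hy, h1, h2⟩ := h.exists_dual a s hs'
    refine ⟨y, ?_, h1, h2⟩
    change y ∈ 𝓜 (t + (c - t - a.degree))
    rwa [show t + (c - t - (a.degree : ℤ)) = c - a.degree by ring]

/-- An element is determined by the `k`-linear map `r ↦ (r • x)_c`. -/
theorem IsCoinduced.eq_zero_of_proj_smul {c : ℤ} (h : IsCoinduced k n 𝓜 c)
    (hM : IsGradedModule k n 𝓜) {x : M}
    (hx : ∀ r : MvPolynomial (Fin n) k, hM.proj c (r • x) = 0) : x = 0 := by
  refine hM.eq_zero_of_proj fun d => h.eq_zero d _ (hM.proj_mem d x) fun a ha => ?_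
  rw [← hM.proj_smul (isHomogeneous_monomial (1 : k) rfl), ha, hx]

/-- A `k`-linear map `ℓ` from a graded module `B` to `M_c` that vanishes outside of degree `c`
lifts on each homogeneous element `b`: some `x` of the same degree satisfies
`(r • x)_c = ℓ (r • b)` for all `r`. -/
theorem IsCoinduced.exists_mem_proj_smul_eq {c : ℤ} (h : IsCoinduced k n 𝓜 c)
    (hM : IsGradedModule k n 𝓜)
    {B : Type w} [AddCommGroup B] [Module (MvPolynomial (Fin n) k) B] {𝓑 : ℤ → AddSubgroup B}
    (hB : IsGradedModule k n 𝓑) (ℓ : B →+ M)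
    (hℓC : ∀ (t : k) (b : B), ℓ ((C t : MvPolynomial (Fin n) k) • b) =
      (C t : MvPolynomial (Fin n) k) • ℓ b)
    (hℓ_mem : ∀ b, ℓ b ∈ 𝓜 c) (hℓ_ne : ∀ d b, b ∈ 𝓑 d → d ≠ c → ℓ b = 0)
    {d : ℤ} {b : B} (hb : b ∈ 𝓑 d) :
    ∃ x ∈ 𝓜 d, ∀ r : MvPolynomial (Fin n) k, hM.proj c (r • x) = ℓ (r • b) := by
  classical
  choose y hy_mem hy_same hy_ne using fun a : Fin n →₀ ℕ =>
    h.exists_dual a (ℓ (monomial a (1 : k) • b)) (hℓ_mem _)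
  let s : Finset (Fin n →₀ ℕ) := (Finsupp.finite_of_degree_eq (σ := Fin n) (c - d).toNat).toFinset
  have hs : ∀ a, a ∈ s ↔ a.degree = (c - d).toNat := fun a => by simp [s]
  by_cases hcd : d ≤ c
  · have hx : ∑ a ∈ s, y a ∈ 𝓜 d := by
      refine sum_mem fun a ha => ?_
      have : c - (a.degree : ℤ) = d := by rw [(hs a).1 ha]; omega
      exact this ▸ hy_mem a
    refine ⟨∑ a ∈ s, y a, hx, fun r => ?_⟩
    induction r using MvPolynomial.induction_on' with
    | add p q hp hq => rw [add_smul, add_smul, map_add, map_add, hp, hq]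
    | monomial e t =>
      rw [← mul_one t, ← C_mul_monomial, mul_smul, mul_smul, hM.proj_C_smul, hℓC]
      congr 1
      by_cases he : e ∈ s
      · rw [Finset.smul_sum, Finset.sum_eq_single_of_mem e he, hy_same,
          hM.proj_of_mem (hℓ_mem _)]
        intro a ha hae
        exact hy_ne a e (by rw [(hs a).1 ha, (hs e).1 he]) (Ne.symm hae)
      · have hne : (e.degree : ℤ) + d ≠ c := fun hed => he ((hs e).2 (by omega))
        rw [hM.proj_of_mem_of_ne (hM.monomial_smul_mem e hx) hne,
          hℓ_ne _ _ (hB.monomial_smul_mem e hb) hne]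
  · refine ⟨0, zero_mem _, fun r => ?_⟩
    rw [smul_zero, map_zero]
    induction r using MvPolynomial.induction_on' with
    | add p q hp hq => rw [add_smul, map_add, ← hp, ← hq, add_zero]
    | monomial e t =>
      rw [← mul_one t, ← C_mul_monomial, mul_smul, hℓC,
        hℓ_ne _ _ (hB.monomial_smul_mem e hb) (by omega), smul_zero]

/-- Coinduction turns the extension problem for graded modules into one for `k`-vector spaces, where
it can always be solved. -/
theorem IsCoinduced.isStarInjective {c : ℤ} (h : IsCoinduced k n 𝓜 c)
    (hM : IsGradedModule k n 𝓜) : IsStarInjective.{u, v, w} k n 𝓜 := by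
  intro A B _ _ _ _ 𝓐 𝓑 hA hB f g hf hf_inj hg
  let : Module k A := Module.compHom A (C : k →+* MvPolynomial (Fin n) k)
  let : Module k B := Module.compHom B (C : k →+* MvPolynomial (Fin n) k)
  let f' : A →ₗ[k] B := { f.toAddMonoidHom with map_smul' := fun t a => f.map_smul (C t) a }
  obtain ⟨L, hL⟩ := f'.exists_leftInverse_of_injective (LinearMap.ker_eq_bot.2 hf_inj)
  have hLf : ∀ a, L (f a) = a := fun a => LinearMap.congr_fun hL a
  -- `ℓ` extends `a ↦ (g a)_c` along `f` and vanishes outside of degree `c`.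
  let ℓ : B →+ M := (hM.proj c).comp (g.toAddMonoidHom.comp (L.toAddMonoidHom.comp (hB.proj c)))
  have hℓ : ∀ b, ℓ b = hM.proj c (g (L (hB.proj c b))) := fun b => rfl
  have hℓC : ∀ (t : k) (b : B), ℓ ((C t : MvPolynomial (Fin n) k) • b) =
      (C t : MvPolynomial (Fin n) k) • ℓ b := by
    intro t b
    have hLC : ∀ b, L ((C t : MvPolynomial (Fin n) k) • b) =
      (C t : MvPolynomial (Fin n) k) • L b := fun b => L.map_smul t b
    rw [hℓ, hℓ, hB.proj_C_smul, hLC, map_smul, hM.proj_C_smul]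
  have hℓf : ∀ a, ℓ (f a) = hM.proj c (g a) := fun a => by
    rw [hℓ, hA.proj_map hB hf, hLf, ← hA.proj_map hM hg, hM.proj_of_mem (hM.proj_mem c _)]
  have lift : ∀ d, ∀ b ∈ 𝓑 d, ∃ x ∈ 𝓜 d,
      ∀ r : MvPolynomial (Fin n) k, hM.proj c (r • x) = ℓ (r • b) := fun d b hb =>
    h.exists_mem_proj_smul_eq hM hB ℓ hℓC (fun b => hM.proj_mem c _)
      (fun d b hb hdc => by rw [hℓ, hB.proj_of_mem_of_ne hb hdc, map_zero, map_zero, map_zero]) hb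
  have lift' : ∀ b, ∃ x, ∀ r : MvPolynomial (Fin n) k, hM.proj c (r • x) = ℓ (r • b) := by
    intro b
    induction b using hB.induction with
    | zero => exact ⟨0, fun r => by simp⟩
    | homogeneous d b hb =>
      obtain ⟨x, -, hx⟩ := lift d b hb
      exact ⟨x, hx⟩
    | add b b' hb hb' =>
      obtain ⟨x, hx⟩ := hb
      obtain ⟨x', hx'⟩ := hb'
      exact ⟨x + x', fun r => by rw [smul_add, smul_add, map_add, map_add, hx, hx']⟩
  choose φ hφ using lift'
  have uniq : ∀ x b, (∀ r : MvPolynomial (Fin n) k, hM.proj c (r • x) = ℓ (r • b)) → φ b = x := by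
    intro x b hx
    refine sub_eq_zero.1 (h.eq_zero_of_proj_smul hM fun r => ?_)
    rw [smul_sub, map_sub, hφ, hx, sub_self]
  refine ⟨{ toFun := φ, map_add' := fun b b' => uniq _ _ fun r => ?_,
            map_smul' := fun s b => uniq _ _ fun r => ?_ }, fun d b hb => ?_, ?_⟩
  · rw [smul_add, smul_add, map_add, map_add, hφ, hφ]
  · rw [RingHom.id_apply, ← mul_smul, ← mul_smul, hφ]
  · obtain ⟨x, hxd, hx⟩ := lift d b hb
    change φ b ∈ 𝓜 d
    rwa [uniq x b hx]
  · ext a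
    refine uniq _ _ fun r => ?_
    rw [← map_smul, ← map_smul, hℓf]

end Coinduced

/-! ### Decomposition of a coinduced module along a basis of its socle -/

section Decomposition

variable {k : Type u} [Field k] {n : ℕ}
  {M : Type v} [AddCommGroup M] [Module (MvPolynomial (Fin n) k) M] {𝓜 : ℤ → AddSubgroup M}

theorem sub_C_coeff_zero_mem_irrelevantIdeal (r : MvPolynomial (Fin n) k) :
    r - C (coeff 0 r) ∈ irrelevantIdeal k n := by
  induction r using MvPolynomial.induction_on with
  | C a => simp
  | add p q hp hq =>
    rw [coeff_add, C_add, add_sub_add_comm]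
    exact add_mem hp hq
  | mul_X p i _ =>
    have : X i ∈ irrelevantIdeal k n := Ideal.subset_span ⟨i, rfl⟩
    have h0 : coeff 0 (p * X i) = 0 := by classical simp [coeff_mul_X']
    rw [h0, C_0, sub_zero]
    exact Ideal.mul_mem_left _ p this

/-- A coinduced module whose top degree part is a line in degree `0` is a `*injective` hull of
`R/𝔪`. -/
theorem IsCoinduced.isStarInjectiveHull (hM : IsGradedModule k n 𝓜) (h : IsCoinduced k n 𝓜 0)
    {s : M} (hs : s ∈ 𝓜 0) (hs0 : s ≠ 0)
    (hgen : ∀ x ∈ 𝓜 0, ∃ t : k, x = (C t : MvPolynomial (Fin n) k) • s) :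
    IsStarInjectiveHull.{u, u, v, w} k n (residueGrading k n) 𝓜 := by
  have hX : ∀ i, (X i : MvPolynomial (Fin n) k) • s = 0 := fun i =>
    h.eq_zero 1 _ (by simpa using hM.smul_mem 1 0 _ s (isHomogeneous_X k i) hs)
      fun a ha => by omega
  have hle : irrelevantIdeal k n ≤ LinearMap.ker (LinearMap.toSpanSingleton _ M s) := by
    refine Ideal.span_le.2 ?_
    rintro _ ⟨i, rfl⟩
    exact hX i
  have hker : LinearMap.ker (LinearMap.toSpanSingleton _ M s) ≤ irrelevantIdeal k n := by
    intro r hr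
    have h1 : (r - C (coeff 0 r)) • s = 0 := hle (sub_C_coeff_zero_mem_irrelevantIdeal r)
    have h2 : r • s = 0 := hr
    rw [sub_smul, h2, zero_sub, neg_eq_zero] at h1
    have h3 : coeff 0 r = 0 := by
      by_contra hne
      refine hs0 ?_
      rw [← one_smul (MvPolynomial (Fin n) k) s, ← C_1, ← inv_mul_cancel₀ hne, C_mul, mul_smul,
        h1, smul_zero]
    simpa [h3] using sub_C_coeff_zero_mem_irrelevantIdeal r
  refine ⟨hM, h.isStarInjective hM,
    Submodule.liftQ (irrelevantIdeal k n) (LinearMap.toSpanSingleton _ M s) hle, ?_,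
    LinearMap.ker_eq_bot.1 (Submodule.ker_liftQ_eq_bot _ _ _ hker), ?_⟩
  · rintro d _ ⟨r, hr, rfl⟩
    change r • s ∈ 𝓜 d
    change r ∈ polyGrading k n d at hr
    unfold polyGrading at hr
    split_ifs at hr with hd
    · have := hM.smul_mem d.toNat 0 r s hr hs
      rwa [add_zero, Int.toNat_of_nonneg hd] at this
    · rw [(AddSubgroup.mem_bot).1 hr, zero_smul]
      exact zero_mem _
  · intro U hU hU0
    obtain ⟨x, hxU, hx0⟩ := (Submodule.ne_bot_iff U).1 hU0
    -- Some homogeneous component of `x` is nonzero, and it has a nonzero multiple in degree `0`.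
    obtain ⟨d, hd⟩ : ∃ d, hU.proj d ⟨x, hxU⟩ ≠ 0 := by
      by_contra! hall
      exact hx0 (congrArg Subtype.val (hU.eq_zero_of_proj hall))
    have hz : ((hU.proj d ⟨x, hxU⟩ : U) : M) ∈ 𝓜 d := hU.proj_mem d _
    obtain ⟨a, had, ha⟩ : ∃ a : Fin n →₀ ℕ, a.degree + d = 0 ∧
        monomial a (1 : k) • ((hU.proj d ⟨x, hxU⟩ : U) : M) ≠ 0 := by
      by_contra! hall
      exact hd (Subtype.ext (h.eq_zero d _ hz hall))
    obtain ⟨t, ht⟩ := hgen _ (had ▸ hM.monomial_smul_mem a hz)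
    exact (Submodule.ne_bot_iff _).2 ⟨_, ⟨U.smul_mem _ (hU.proj d ⟨x, hxU⟩).2,
      ⟨Submodule.Quotient.mk (C t), ht.symm⟩⟩, ha⟩

theorem IsCoinduced.isStarEShift (hM : IsGradedModule k n 𝓜) {c : ℤ} (h : IsCoinduced k n 𝓜 c)
    {s : M} (hs : s ∈ 𝓜 c) (hs0 : s ≠ 0)
    (hgen : ∀ x ∈ 𝓜 c, ∃ t : k, x = (C t : MvPolynomial (Fin n) k) • s) :
    IsStarEShift.{u, v, w} k n 𝓜 (-c) := by
  have h0 : ∀ x, x ∈ _root_.shiftGrading 𝓜 c 0 ↔ x ∈ 𝓜 c := fun x => by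
    simp [_root_.shiftGrading]
  unfold IsStarEShift
  rw [neg_neg]
  exact IsCoinduced.isStarInjectiveHull (hM.shiftGrading c) (by simpa using h.shiftGrading c)
    ((h0 s).2 hs) hs0 fun x hx => hgen x ((h0 x).1 hx)

variable [Module k M]

/-- The largest graded submodule of `M` whose part of degree `c` lies in the `k`-subspace `V`: it
consists of the `x` such that the part of degree `c` of every multiple of `x` lies in `V`. -/
noncomputable def IsGradedModule.coinducedSubmodule (hM : IsGradedModule k n 𝓜) (c : ℤ)
    (V : Submodule k M) : Submodule (MvPolynomial (Fin n) k) M where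
  carrier := {x | ∀ r : MvPolynomial (Fin n) k, hM.proj c (r • x) ∈ V}
  zero_mem' r := by simp
  add_mem' hx hy r := by
    rw [smul_add, map_add]
    exact V.add_mem (hx r) (hy r)
  smul_mem' s x hx r := by
    rw [← mul_smul]
    exact hx (r * s)

theorem IsGradedModule.mem_of_mem_coinducedSubmodule (hM : IsGradedModule k n 𝓜) {c : ℤ}
    {V : Submodule k M} {x : M} (hxV : x ∈ hM.coinducedSubmodule c V) (hx : x ∈ 𝓜 c) : x ∈ V := by
  simpa [hM.proj_of_mem hx] using hxV 1

theorem IsGradedModule.coinducedSubmodule_mono (hM : IsGradedModule k n 𝓜) (c : ℤ) :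
    Monotone (hM.coinducedSubmodule c) :=
  fun _ _ hVW _ hx r => hVW (hx r)

theorem IsCoinduced.iSupIndep_coinducedSubmodule (hM : IsGradedModule k n 𝓜) {c : ℤ}
    (h : IsCoinduced k n 𝓜 c) {ι : Type*} {V : ι → Submodule k M} (hV : iSupIndep V) :
    iSupIndep fun i => hM.coinducedSubmodule c (V i) := by
  intro i
  rw [Submodule.disjoint_def]
  intro x hx hx'
  have hle : ⨆ j, ⨆ (_ : j ≠ i), hM.coinducedSubmodule c (V j) ≤
      hM.coinducedSubmodule c (⨆ j, ⨆ (_ : j ≠ i), V j) :=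
    iSup₂_le fun j hj => hM.coinducedSubmodule_mono c (le_iSup₂_of_le j hj le_rfl)
  exact h.eq_zero_of_proj_smul hM fun r =>
    Submodule.disjoint_def.1 (hV i) _ (hx r) (hle hx' r)

variable [IsScalarTower k (MvPolynomial (Fin n) k) M]

theorem IsGradedModule.mem_coinducedSubmodule_of_monomial (hM : IsGradedModule k n 𝓜) {c : ℤ}
    {V : Submodule k M} {x : M}
    (hx : ∀ a : Fin n →₀ ℕ, hM.proj c (monomial a (1 : k) • x) ∈ V) :
    x ∈ hM.coinducedSubmodule c V := by
  intro r
  induction r using MvPolynomial.induction_on' with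
  | add p q hp hq =>
    rw [add_smul, map_add]
    exact V.add_mem hp hq
  | monomial e t =>
    rw [← mul_one t, ← C_mul_monomial, mul_smul, hM.proj_C_smul, ← algebraMap_eq, algebraMap_smul]
    exact V.smul_mem t (hx e)

theorem IsGradedModule.isGradedSubmodule_coinducedSubmodule (hM : IsGradedModule k n 𝓜) (c : ℤ)
    (V : Submodule k M) : IsGradedSubmodule k n 𝓜 (hM.coinducedSubmodule c V) := by
  refine hM.isGradedSubmodule fun d x hx => hM.mem_coinducedSubmodule_of_monomial fun a => ?_
  by_cases had : (a.degree : ℤ) + d = c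
  · rw [← hM.proj_smul (isHomogeneous_monomial (1 : k) rfl), had, hM.proj_of_mem (hM.proj_mem c _)]
    exact hx _
  · rw [hM.proj_of_mem_of_ne (hM.monomial_smul_mem a (hM.proj_mem d x)) had]
    exact V.zero_mem

theorem IsGradedModule.mem_coinducedSubmodule_of_dual (hM : IsGradedModule k n 𝓜) {c : ℤ}
    {V : Submodule k M} {a : Fin n →₀ ℕ} {y : M} (hy : y ∈ 𝓜 (c - a.degree))
    (h_same : monomial a (1 : k) • y ∈ V)
    (h_ne : ∀ b : Fin n →₀ ℕ, b.degree = a.degree → b ≠ a → monomial b (1 : k) • y = 0) :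
    y ∈ hM.coinducedSubmodule c V := by
  refine hM.mem_coinducedSubmodule_of_monomial fun b => ?_
  have hby := hM.monomial_smul_mem b hy
  by_cases hdeg : b.degree = a.degree
  · by_cases hba : b = a
    · subst hba
      rw [add_sub_cancel] at hby
      rwa [hM.proj_of_mem hby]
    · rw [h_ne b hdeg hba, map_zero]
      exact V.zero_mem
  · rw [hM.proj_of_mem_of_ne hby (by omega)]
    exact V.zero_mem

theorem IsCoinduced.coinducedSubmodule (hM : IsGradedModule k n 𝓜) {c : ℤ}
    (h : IsCoinduced k n 𝓜 c) (V : Submodule k M) :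
    IsCoinduced k n (inducedGrading k n 𝓜 (hM.coinducedSubmodule c V)) c where
  eq_zero d x hx ha :=
    Subtype.ext (h.eq_zero d x hx fun a had => congrArg Subtype.val (ha a had))
  exists_dual a s hs := by
    obtain ⟨y, hy, h1, h2⟩ := h.exists_dual a s hs
    have hyV : y ∈ hM.coinducedSubmodule c V := hM.mem_coinducedSubmodule_of_dual hy
      (h1 ▸ hM.mem_of_mem_coinducedSubmodule s.2 hs) h2
    exact ⟨⟨y, hyV⟩, hy, Subtype.ext h1, fun b hb hba => Subtype.ext (h2 b hb hba)⟩

theorem IsCoinduced.iSup_coinducedSubmodule (hM : IsGradedModule k n 𝓜) {c : ℤ}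
    (h : IsCoinduced k n 𝓜 c) {ι : Type*} {V : ι → Submodule k M}
    (hV_le : ∀ i, ∀ x ∈ V i, x ∈ 𝓜 c) (hV : ∀ x ∈ 𝓜 c, x ∈ ⨆ i, V i) :
    ⨆ i, hM.coinducedSubmodule c (V i) = ⊤ := by
  classical
  set T := ⨆ i, hM.coinducedSubmodule c (V i)
  have dual : ∀ (a : Fin n →₀ ℕ) (s : M), s ∈ ⨆ i, V i → ∃ y ∈ T, y ∈ 𝓜 (c - a.degree) ∧
      monomial a (1 : k) • y = s ∧
      ∀ b : Fin n →₀ ℕ, b.degree = a.degree → b ≠ a → monomial b (1 : k) • y = 0 := by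
    intro a s hs
    induction hs using Submodule.iSup_induction' with
    | mem i s hs =>
      obtain ⟨y, hy, h1, h2⟩ := h.exists_dual a s (hV_le i s hs)
      exact ⟨y, Submodule.mem_iSup_of_mem i
        (hM.mem_coinducedSubmodule_of_dual hy (h1 ▸ hs) h2), hy, h1, h2⟩
    | zero => exact ⟨0, zero_mem _, zero_mem _, by simp⟩
    | add s t _ _ hs ht =>
      obtain ⟨y, hyT, hy, h1, h2⟩ := hs
      obtain ⟨z, hzT, hz, h3, h4⟩ := ht
      exact ⟨y + z, add_mem hyT hzT, add_mem hy hz, by rw [smul_add, h1, h3],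
        fun b hb hba => by rw [smul_add, h2 b hb hba, h4 b hb hba, add_zero]⟩
  refine eq_top_iff.2 fun x _ => ?_
  induction x using hM.induction with
  | zero => exact T.zero_mem
  | add x y hx hy => exact T.add_mem (hx trivial) (hy trivial)
  | homogeneous d x hx =>
    let s : Finset (Fin n →₀ ℕ) :=
      (Finsupp.finite_of_degree_eq (σ := Fin n) (c - d).toNat).toFinset
    have hs : ∀ a, a ∈ s ↔ a.degree = (c - d).toNat := fun a => by simp [s]
    by_cases hcd : d ≤ c
    · have hdeg : ∀ a ∈ s, (a.degree : ℤ) + d = c := fun a ha => by rw [(hs a).1 ha]; omega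
      have hmem : ∀ a : s, monomial a.1 (1 : k) • x ∈ ⨆ i, V i := fun a =>
        hV _ (hdeg a a.2 ▸ hM.monomial_smul_mem a.1 hx)
      choose y hyT hy h1 h2 using fun a : s => dual a.1 _ (hmem a)
      have hx_eq : x - ∑ a, y a = 0 := by
        refine h.eq_zero d _ (sub_mem hx (sum_mem fun a _ => ?_)) fun e he => ?_
        · have : c - (a.1.degree : ℤ) = d := by linarith [hdeg a a.2]
          exact this ▸ hy a
        · have hes : e ∈ s := (hs e).2 (by omega)
          rw [smul_sub, Finset.smul_sum, Finset.sum_eq_single (⟨e, hes⟩ : s)]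
          · exact sub_eq_zero.2 (h1 ⟨e, hes⟩).symm
          · intro a _ hae
            exact h2 a e (by rw [(hs _).1 a.2, (hs e).1 hes]) fun hea => hae (Subtype.ext hea.symm)
          · simp
      rw [sub_eq_zero.1 hx_eq]
      exact sum_mem fun a _ => hyT a
    · rw [h.eq_zero d x hx fun a ha => by omega]
      exact T.zero_mem

end Decomposition

section DecompositionExists

variable {k : Type u} [Field k] {n : ℕ}
  {M : Type v} [AddCommGroup M] [Module (MvPolynomial (Fin n) k) M] {𝓜 : ℤ → AddSubgroup M}

/-- A coinduced module is a direct sum of shifts of `*E(R/𝔪)`, indexed by a `k`-basis of its part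
of degree `c`. -/
theorem IsCoinduced.exists_decomposition (hM : IsGradedModule k n 𝓜) {c : ℤ}
    (h : IsCoinduced k n 𝓜 c) :
    ∃ (ι : Type v) (N : ι → Submodule (MvPolynomial (Fin n) k) M),
      iSupIndep N ∧ iSup N = ⊤ ∧
      ∀ i, IsGradedSubmodule k n 𝓜 (N i) ∧
        IsStarEShift.{u, v, w} k n (inducedGrading k n 𝓜 (N i)) (-c) := by
  let : Module k M := Module.compHom M (C : k →+* MvPolynomial (Fin n) k)
  have hC : ∀ (t : k) (x : M), t • x = (C t : MvPolynomial (Fin n) k) • x := fun _ _ => rfl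
  have : IsScalarTower k (MvPolynomial (Fin n) k) M :=
    ⟨fun t r x => by rw [hC, ← mul_smul, smul_eq_C_mul]⟩
  let S : Submodule k M :=
    { 𝓜 c with smul_mem' := fun t x hx => hM.C_smul_mem t hx }
  let b := Module.Basis.ofVectorSpace k S
  let V : Module.Basis.ofVectorSpaceIndex k S → Submodule k M := fun i => k ∙ (b i : M)
  have hV_le : ∀ i, ∀ x ∈ V i, x ∈ 𝓜 c := fun i x hx =>
    (Submodule.span_singleton_le_iff_mem _ S).2 (b i).2 hx
  have hV_indep : iSupIndep V :=
    (b.linearIndependent.map' S.subtype S.ker_subtype).iSupIndep_span_singleton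
  have hV_top : ∀ x ∈ 𝓜 c, x ∈ ⨆ i, V i := by
    intro x hx
    have hb : (⟨x, hx⟩ : S) ∈ Submodule.span k (Set.range b) := b.mem_span _
    have hx' := Submodule.mem_map_of_mem (f := S.subtype) hb
    rw [Submodule.map_span, ← Set.range_comp] at hx'
    rwa [← Submodule.span_range_eq_iSup]
  have hb_mem : ∀ i, (b i : M) ∈ hM.coinducedSubmodule c (V i) := fun i =>
    hM.mem_coinducedSubmodule_of_dual (a := 0) (by simp)
      (by
        rw [monomial_zero', C_1, one_smul]
        exact Submodule.mem_span_singleton_self (b i : M))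
      fun a ha ha0 => absurd ((Finsupp.degree_eq_zero_iff a).1 (by simpa using ha)) ha0
  refine ⟨_, fun i => hM.coinducedSubmodule c (V i), h.iSupIndep_coinducedSubmodule hM hV_indep,
    h.iSup_coinducedSubmodule hM hV_le hV_top,
    fun i => ⟨hM.isGradedSubmodule_coinducedSubmodule c (V i), ?_⟩⟩
  refine (h.coinducedSubmodule hM (V i)).isStarEShift
    (hM.isGradedSubmodule_coinducedSubmodule c (V i)) (s := ⟨b i, hb_mem i⟩) (b i).2 ?_ ?_
  · intro hbi
    have hbi' : (b i : M) = 0 := congrArg Subtype.val hbi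
    exact b.ne_zero i (Subtype.ext hbi')
  · intro x hx
    obtain ⟨t, ht⟩ := Submodule.mem_span_singleton.1 (hM.mem_of_mem_coinducedSubmodule x.2 hx)
    exact ⟨t, Subtype.ext ht.symm⟩

end DecompositionExists

/-! ### Graded modules with zero-dimensional support -/

section Support

variable {k : Type u} [Field k] {n : ℕ}
  {M : Type v} [AddCommGroup M] [Module (MvPolynomial (Fin n) k) M] {𝓜 : ℤ → AddSubgroup M}

theorem IsGradedModule.proj_smul_of_mem (hM : IsGradedModule k n 𝓜) {d : ℤ} {x : M}
    (hx : x ∈ 𝓜 d) (i : ℕ) (r : MvPolynomial (Fin n) k) :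
    hM.proj (i + d) (r • x) = homogeneousComponent i r • x := by
  induction r using MvPolynomial.induction_on' with
  | add p q hp hq => rw [add_smul, map_add, map_add, add_smul, hp, hq]
  | monomial a t =>
    have ha : (monomial a t).IsHomogeneous a.degree := isHomogeneous_monomial t rfl
    have hmem := hM.smul_mem _ d _ x ha hx
    rw [homogeneousComponent_of_mem ha]
    split_ifs with h
    · subst h
      rw [hM.proj_of_mem hmem]
    · rw [hM.proj_of_mem_of_ne hmem (by omega), zero_smul]

attribute [local instance] MvPolynomial.gradedAlgebra in
theorem IsGradedModule.annihilator_isHomogeneous (hM : IsGradedModule k n 𝓜) {d : ℤ} {x : M}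
    (hx : x ∈ 𝓜 d) :
    (Submodule.span (MvPolynomial (Fin n) k) {x}).annihilator.IsHomogeneous
      (homogeneousSubmodule (Fin n) k) := by
  intro i r hr
  rw [Submodule.mem_annihilator_span_singleton] at hr ⊢
  have h : homogeneousComponent i r • x = 0 := by
    rw [← hM.proj_smul_of_mem hx, hr, map_zero]
  rwa [← decomposition.decompose'_apply] at h

attribute [local instance] MvPolynomial.gradedAlgebra in
/-- The homogeneous core of a prime ideal of the support that contains the annihilator of a
homogeneous `x` is again in the support. It is contained in `𝔪`, hence equal to `𝔪` if the support
has dimension `≤ 0`. So `𝔪` lies in the radical of the annihilator of `x`. -/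
theorem IsGradedModule.exists_X_pow_smul_eq_zero (hM : IsGradedModule k n 𝓜)
    (hdim : Module.supportDim (MvPolynomial (Fin n) k) M ≤ 0) {d : ℤ} {x : M}
    (hx : x ∈ 𝓜 d) (j : Fin n) : ∃ N : ℕ, (X j : MvPolynomial (Fin n) k) ^ N • x = 0 := by
  set I := (Submodule.span (MvPolynomial (Fin n) k) {x}).annihilator with hI
  have hI_hom : I.IsHomogeneous (homogeneousSubmodule (Fin n) k) :=
    hM.annihilator_isHomogeneous hx
  suffices h : X j ∈ I.radical by
    obtain ⟨N, hN⟩ := h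
    exact ⟨N, (Submodule.mem_annihilator_span_singleton _ _).1 hN⟩
  rw [Ideal.radical_eq_sInf, Ideal.mem_sInf]
  rintro P ⟨hIP, hP⟩
  set Q := P.homogeneousCore (homogeneousSubmodule (Fin n) k) with hQ
  have hQ_prime : Q.toIdeal.IsPrime := hP.homogeneousCore
  have hIQ : I ≤ Q.toIdeal := by
    rw [← hI_hom.toIdeal_homogeneousCore_eq_self]
    exact Ideal.homogeneousCore_mono _ hIP
  let m : Ideal (MvPolynomial (Fin n) k) := RingHom.ker (constantCoeff (σ := Fin n) (R := k))
  have hm : m.IsPrime := RingHom.ker_isPrime _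
  have hQm : Q.toIdeal ≤ m := by
    intro f hf
    have h0 : homogeneousComponent 0 f ∈ Q.toIdeal := by
      have := Q.isHomogeneous 0 hf
      rwa [← decomposition.decompose'_apply]
    rw [homogeneousComponent_zero] at h0
    by_contra hne
    have hu : IsUnit (C (coeff 0 f) : MvPolynomial (Fin n) k) :=
      (IsUnit.mk0 (coeff 0 f) hne).map C
    exact hQ_prime.ne_top (Ideal.eq_top_of_isUnit_mem _ h0 hu)
  have hQ_supp : (⟨Q.toIdeal, hQ_prime⟩ : PrimeSpectrum (MvPolynomial (Fin n) k)) ∈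
      Module.support (MvPolynomial (Fin n) k) M :=
    Module.mem_support_iff_exists_annihilator.2 ⟨x, hIQ⟩
  have hm_supp : (⟨m, hm⟩ : PrimeSpectrum (MvPolynomial (Fin n) k)) ∈
      Module.support (MvPolynomial (Fin n) k) M :=
    Module.mem_support_mono hQm hQ_supp
  have hmax := Order.krullDim_nonpos_iff_forall_isMax.1 hdim ⟨_, hQ_supp⟩
  have hmQ : m ≤ Q.toIdeal := hmax (b := ⟨_, hm_supp⟩) hQm
  exact Ideal.toIdeal_homogeneousCore_le _ P (hmQ (constantCoeff_X _ j))

theorem X_smul_monomial_smul (j : Fin n) (a : Fin n →₀ ℕ) (x : M) :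
    (X j : MvPolynomial (Fin n) k) • monomial a (1 : k) • x =
      monomial (a + Finsupp.single j 1) (1 : k) • x := by
  rw [← mul_smul, mul_comm, monomial_add_single, pow_one]

theorem monomial_smul_eq_zero_of_le {a : Fin n →₀ ℕ} {x : M} {j : Fin n} {N : ℕ} (hN : N ≤ a j)
    (hx : (X j : MvPolynomial (Fin n) k) ^ N • x = 0) : monomial a (1 : k) • x = 0 := by
  rw [← tsub_add_cancel_of_le (Finsupp.single_le_iff.2 hN), monomial_add_single, mul_smul, hx,
    smul_zero]

/-- A nonzero element killed by powers of the variables has a nonzero multiple in the socle. -/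
theorem exists_monomial_smul_ne_zero {x : M} (hx0 : x ≠ 0)
    (hx : ∀ j, ∃ N : ℕ, (X j : MvPolynomial (Fin n) k) ^ N • x = 0) :
    ∃ a : Fin n →₀ ℕ, monomial a (1 : k) • x ≠ 0 ∧
      ∀ j, (X j : MvPolynomial (Fin n) k) • monomial a (1 : k) • x = 0 := by
  choose N hN using hx
  have hfin : {a : Fin n →₀ ℕ | monomial a (1 : k) • x ≠ 0}.Finite := by
    refine (Set.finite_Iic (Finsupp.equivFunOnFinite.symm N)).subset fun a ha j => ?_
    by_contra! hlt
    exact ha (monomial_smul_eq_zero_of_le hlt.le (hN j))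
  obtain ⟨a, ha⟩ := hfin.exists_maximal ⟨0, by simpa using hx0⟩
  refine ⟨a, ha.prop, fun j => ?_⟩
  rw [X_smul_monomial_smul]
  by_contra hne
  have h1 := ha.le_of_ge hne le_self_add j
  simp at h1

end Support

/-! ### A basis of `R'` over `R` and coordinates on `F(M)` -/

section FrobeniusBasis

variable {k : Type u} [Field k] {n : ℕ} {p : ℕ}

/-- The exponent vector in `{0, …, p - 1} ^ n`, as a finitely supported function. -/
noncomputable def digitExponent (r : Fin n → Fin p) : Fin n →₀ ℕ :=
  Finsupp.equivFunOnFinite.symm fun j => (r j : ℕ)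

@[simp]
theorem digitExponent_apply (r : Fin n → Fin p) (j : Fin n) : digitExponent r j = r j :=
  rfl

theorem monomial_pow_mul (a : Fin n →₀ ℕ) (t c : k) :
    monomial a (t ^ p * c) = monomial a c * (C t : MvPolynomial (Fin n) k) ^ p := by
  rw [← C_pow, mul_comm (monomial a c), C_mul_monomial]

variable [Fact p.Prime] [CharP k p]

theorem FrobeniusCopy.smul_of {R : Type*} [CommRing R] [CharP R p] (r s : R) :
    r • FrobeniusCopy.of p R s = FrobeniusCopy.of p R (r ^ p * s) :=
  rfl

/-- Division with remainder by `p` of all exponents at once. -/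
theorem exists_eq_nsmul_add_digitExponent (p : ℕ) [Fact p.Prime] (a : Fin n →₀ ℕ) :
    ∃ (q : Fin n →₀ ℕ) (r : Fin n → Fin p), a = p • q + digitExponent r := by
  have hp : 0 < p := (Fact.out : p.Prime).pos
  refine ⟨Finsupp.equivFunOnFinite.symm fun j => a j / p, fun j => ⟨a j % p, Nat.mod_lt _ hp⟩, ?_⟩
  ext j
  simp [Nat.div_add_mod]

theorem coeff_nsmul_pow_char (f : MvPolynomial (Fin n) k) (a : Fin n →₀ ℕ) :
    coeff (p • a) (f ^ p) = coeff a f ^ p := by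
  rw [← map_frobenius_expand p, coeff_map, coeff_expand_smul p (Fact.out : p.Prime).ne_zero,
    frobenius_def]

theorem coeff_pow_char_of_not_dvd (f : MvPolynomial (Fin n) k) {a : Fin n →₀ ℕ} {j : Fin n}
    (h : ¬ p ∣ a j) : coeff a (f ^ p) = 0 := by
  rw [← map_frobenius_expand p, coeff_map, coeff_expand_of_not_dvd f h, map_zero]

variable {Λ : Type*} (B : Module.Basis Λ k (FrobeniusCopy p k))

/-- The element `λ X ^ r` of `R`, for `λ` in a basis of `k` over its subfield of `p`-th powers and
`r ∈ {0, …, p - 1} ^ n`. These elements form a basis of `R'` over `R`. A basis of `k` over its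
`p`-th powers is encoded as a basis of the copy `k'` of `k` over `k`, acting through Frobenius. -/
noncomputable def frobeniusMonomial (i : Λ × (Fin n → Fin p)) : MvPolynomial (Fin n) k :=
  monomial (digitExponent i.2) ((FrobeniusCopy.of p k).symm (B i.1))

theorem coeff_pow_mul_frobeniusMonomial (f : MvPolynomial (Fin n) k) (a : Fin n →₀ ℕ)
    (r : Fin n → Fin p) (i : Λ × (Fin n → Fin p)) [Decidable (i.2 = r)] :
    coeff (p • a + digitExponent r) (f ^ p * frobeniusMonomial B i) =
      if i.2 = r then coeff a f ^ p * (FrobeniusCopy.of p k).symm (B i.1) else 0 := by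
  classical
  rw [frobeniusMonomial, coeff_mul_monomial']
  split_ifs with hle hir hir
  · rw [hir, add_tsub_cancel_right, coeff_nsmul_pow_char]
  · obtain ⟨j, hj⟩ := Function.ne_iff.1 hir
    rw [coeff_pow_char_of_not_dvd (j := j), zero_mul]
    have hlej := hle j
    simp only [Finsupp.add_apply, Finsupp.smul_apply, digitExponent_apply, smul_eq_mul,
      Finsupp.tsub_apply] at hlej ⊢
    rintro ⟨t, ht⟩
    have h1 : p * a j + (r j : ℕ) = p * t + (i.2 j : ℕ) := by omega
    have h2 : (r j : ℕ) = i.2 j := by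
      have := congrArg (· % p) h1
      simpa [Nat.mod_eq_of_lt (r j).2, Nat.mod_eq_of_lt (i.2 j).2] using this
    exact hj (Fin.ext h2.symm)
  · exact absurd (by rw [hir]; exact le_add_self) hle
  · rfl

theorem linearIndependent_frobeniusMonomial :
    LinearIndependent (MvPolynomial (Fin n) k)
      fun i : Λ × (Fin n → Fin p) => FrobeniusCopy.of p _ (frobeniusMonomial B i) := by
  classical
  rw [linearIndependent_iff']
  intro s g hg i hi
  ext a
  have h1 : ∑ j ∈ s, g j ^ p * frobeniusMonomial B j = 0 := hg
  have h2 := congrArg (coeff (p • a + digitExponent i.2)) h1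
  simp only [coeff_sum, coeff_pow_mul_frobeniusMonomial, coeff_zero] at h2
  have h3 : ∑ j ∈ s, (if j.2 = i.2 then coeff a (g j) • B j.1 else 0) = 0 := by
    refine Eq.trans (Finset.sum_congr rfl fun j _ => ?_) h2
    split_ifs <;> rfl
  have h4 := congrArg (fun z => B.repr z i.1) h3
  simp only [map_sum, Finsupp.finsetSum_apply, map_zero, Finsupp.zero_apply] at h4
  rw [Finset.sum_eq_single_of_mem i hi] at h4
  · simpa using h4
  · intro j _ hji
    split_ifs with hj
    · have : j.1 ≠ i.1 := fun h => hji (Prod.ext h hj)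
      simp [this]
    · simp

theorem monomial_nsmul_add_digitExponent (q : Fin n →₀ ℕ) (r : Fin n → Fin p) (l : Λ) :
    monomial (p • q + digitExponent r) ((FrobeniusCopy.of p k).symm (B l)) =
      frobeniusMonomial B (l, r) * monomial q (1 : k) ^ p := by
  rw [frobeniusMonomial, monomial_pow, monomial_mul, one_pow, mul_one, add_comm]

theorem span_frobeniusMonomial :
    ⊤ ≤ Submodule.span (MvPolynomial (Fin n) k) (Set.range fun i : Λ × (Fin n → Fin p) =>
      FrobeniusCopy.of p _ (frobeniusMonomial B i)) := by
  rintro f -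
  obtain ⟨f, rfl⟩ := (FrobeniusCopy.of p _).surjective f
  induction f using MvPolynomial.induction_on' with
  | add f g hf hg => rw [map_add]; exact add_mem hf hg
  | monomial a c =>
    obtain ⟨q, r, rfl⟩ := exists_eq_nsmul_add_digitExponent p a
    have hc := B.mem_span (FrobeniusCopy.of p k c)
    rw [← (FrobeniusCopy.of p k).symm_apply_apply c]
    generalize FrobeniusCopy.of p k c = c at hc
    induction hc using Submodule.span_induction with
    | mem c hc =>
      obtain ⟨l, rfl⟩ := hc
      rw [monomial_nsmul_add_digitExponent, mul_comm, ← FrobeniusCopy.smul_of]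
      exact Submodule.smul_mem _ _ (Submodule.subset_span ⟨(l, r), rfl⟩)
    | zero => simp
    | add x y _ _ hx hy =>
      rw [map_add, map_add, map_add]
      exact add_mem hx hy
    | smul t x _ hx =>
      have h : (FrobeniusCopy.of p k).symm (t • x) = t ^ p * (FrobeniusCopy.of p k).symm x := rfl
      rw [h, monomial_pow_mul, mul_comm, ← FrobeniusCopy.smul_of]
      exact Submodule.smul_mem _ _ hx

/-- The basis `λ X ^ r` of `R'` over `R`. -/
noncomputable def frobeniusBasis :
    Module.Basis (Λ × (Fin n → Fin p)) (MvPolynomial (Fin n) k)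
      (FrobeniusCopy p (MvPolynomial (Fin n) k)) :=
  Module.Basis.mk (linearIndependent_frobeniusMonomial B) (span_frobeniusMonomial B)

theorem frobeniusBasis_apply (i : Λ × (Fin n → Fin p)) :
    frobeniusBasis B i = FrobeniusCopy.of p _ (frobeniusMonomial B i) :=
  Module.Basis.mk_apply _ _ i

variable {M : Type v} [AddCommGroup M] [Module (MvPolynomial (Fin n) k) M]

open Classical in
/-- The coordinates of an element of `F(M)`: the family `m` such that the element is the sum of the
`λ X ^ r ⊗ m_{λ, r}`. -/
noncomputable def FrobeniusPullback.coords :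
    FrobeniusPullback p (MvPolynomial (Fin n) k) M ≃+ (Λ × (Fin n → Fin p) →₀ M) :=
  (TensorProduct.equivFinsuppOfBasisLeft (N := M) (frobeniusBasis (n := n) B)).toAddEquiv

theorem FrobeniusPullback.coords_tmul (i : Λ × (Fin n → Fin p)) (m : M) :
    coords B (tmul p (frobeniusMonomial B i) m) = Finsupp.single i m := by
  classical
  change TensorProduct.equivFinsuppOfBasisLeft (frobeniusBasis B)
    (FrobeniusCopy.of p _ (frobeniusMonomial B i) ⊗ₜ[MvPolynomial (Fin n) k] m) = _
  rw [← frobeniusBasis_apply, TensorProduct.equivFinsuppOfBasisLeft_apply_tmul]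
  simp

theorem FrobeniusPullback.sum_coords (z : FrobeniusPullback p (MvPolynomial (Fin n) k) M) :
    (coords B z).sum (fun i m => tmul p (frobeniusMonomial B i) m) = z := by
  apply (coords B).injective
  rw [map_finsuppSum]
  simp only [coords_tmul, Finsupp.sum_single]

theorem FrobeniusPullback.tmul_add (r : MvPolynomial (Fin n) k) (x y : M) :
    tmul p r (x + y) = tmul p r x + tmul p r y :=
  TensorProduct.tmul_add _ _ _

theorem FrobeniusPullback.add_tmul (r s : MvPolynomial (Fin n) k) (x : M) :
    tmul p (r + s) x = tmul p r x + tmul p s x :=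
  TensorProduct.add_tmul _ _ _

theorem FrobeniusPullback.tmul_zero (r : MvPolynomial (Fin n) k) :
    tmul p r (0 : M) = 0 :=
  TensorProduct.tmul_zero _ _

theorem FrobeniusPullback.zero_tmul (x : M) :
    tmul p (0 : MvPolynomial (Fin n) k) x = 0 :=
  TensorProduct.zero_tmul _ _

/-- Multiplication by `X_j` adds `1` to the digit `r j`; if this digit is `p - 1`, it becomes `0` and
the carry is a factor `X_j ^ p`, the image of `X_j` under Frobenius. -/
theorem X_mul_frobeniusMonomial (j : Fin n) (l : Λ) (r : Fin n → Fin p) :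
    X j * frobeniusMonomial B (l, r) = frobeniusMonomial B (l, r + Pi.single j 1) *
      (if (r j : ℕ) + 1 = p then X j else 1) ^ p := by
  have hp : 1 < p := (Fact.out : p.Prime).one_lt
  have key : Finsupp.single j 1 + digitExponent r = digitExponent (r + Pi.single j 1) +
      p • Finsupp.single j (if (r j : ℕ) + 1 = p then 1 else 0) := by
    ext i
    by_cases hij : i = j
    · subst hij
      have hlt := (r i).2
      have h1 : ((r i + 1 : Fin p) : ℕ) = ((r i : ℕ) + 1) % p := by
        rw [Fin.val_add, Fin.val_one', Nat.mod_eq_of_lt hp]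
      simp only [Finsupp.add_apply, Finsupp.single_eq_same, digitExponent_apply, Pi.add_apply,
        Pi.single_eq_same, Finsupp.smul_apply, smul_eq_mul, h1]
      split_ifs with h
      · rw [h, Nat.mod_self]; omega
      · rw [Nat.mod_eq_of_lt (by omega)]; omega
    · simp [hij]
  have hpow : ((if (r j : ℕ) + 1 = p then X j else 1) : MvPolynomial (Fin n) k) ^ p =
      monomial (p • Finsupp.single j (if (r j : ℕ) + 1 = p then 1 else 0)) 1 := by
    split_ifs
    · rw [X, monomial_pow, one_pow]
    · simp
  rw [hpow, frobeniusMonomial, frobeniusMonomial, X, monomial_mul, monomial_mul, one_mul, mul_one,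
    key]

theorem FrobeniusPullback.coords_X_smul (j : Fin n) (l : Λ) (r : Fin n → Fin p)
    (z : FrobeniusPullback p (MvPolynomial (Fin n) k) M) :
    coords B ((X j : MvPolynomial (Fin n) k) • z) (l, r + Pi.single j 1) =
      (if (r j : ℕ) + 1 = p then X j else 1 : MvPolynomial (Fin n) k) • coords B z (l, r) := by
  classical
  rw [← sum_coords B z]
  generalize coords B z = f
  induction f using Finsupp.induction_linear with
  | zero => simp
  | add f g hf hg =>
    rw [Finsupp.sum_add_index' (fun i => tmul_zero _) (fun i => tmul_add _), smul_add, map_add,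
      map_add, Finsupp.add_apply, Finsupp.add_apply, smul_add, hf, hg]
  | single i m =>
    obtain ⟨l', r'⟩ := i
    rw [Finsupp.sum_single_index (h := fun i m => tmul p (frobeniusMonomial B i) m) (tmul_zero _),
      smul_tmul, X_mul_frobeniusMonomial, ← tmul_smul,
      coords_tmul, coords_tmul]
    by_cases h : (l', r') = (l, r)
    · obtain ⟨rfl, rfl⟩ := Prod.ext_iff.1 h
      simp
    · have h' : (l', r' + Pi.single j 1) ≠ (l, r + Pi.single j 1) := by
        simpa using h
      rw [Finsupp.single_eq_of_ne (Ne.symm h'), Finsupp.single_eq_of_ne (Ne.symm h), smul_zero]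

/-- The coordinates of a socle element of `F(M)` vanish, except for those at the `λ X ^ (p - 1)`. -/
theorem FrobeniusPullback.coords_eq_zero_of_socle
    {z : FrobeniusPullback p (MvPolynomial (Fin n) k) M}
    (hz : ∀ j, (X j : MvPolynomial (Fin n) k) • z = 0) {l : Λ} {r : Fin n → Fin p} {j : Fin n}
    (hr : (r j : ℕ) + 1 ≠ p) : coords B z (l, r) = 0 := by
  have := coords_X_smul B j l r z
  rw [hz, map_zero, if_neg hr, one_smul] at this
  exact this.symm

theorem FrobeniusPullback.X_smul_coords_of_socle
    {z : FrobeniusPullback p (MvPolynomial (Fin n) k) M}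
    (hz : ∀ j, (X j : MvPolynomial (Fin n) k) • z = 0) (i : Λ × (Fin n → Fin p)) (j : Fin n) :
    (X j : MvPolynomial (Fin n) k) • coords B z i = 0 := by
  by_cases hr : (i.2 j : ℕ) + 1 = p
  · have := coords_X_smul B j i.1 i.2 z
    rw [hz, map_zero, if_pos hr] at this
    exact this.symm
  · rw [show i = (i.1, i.2) from rfl, coords_eq_zero_of_socle B hz hr, smul_zero]

/-- The coordinates of an element of `F(M)_d` at `λ X ^ r` have components in those degrees `e` only
for which `|r| + p e = d`. -/
theorem FrobeniusPullback.proj_coords_eq_zero {𝓜 : ℤ → AddSubgroup M}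
    (hM : IsGradedModule k n 𝓜) {d : ℤ} {z : FrobeniusPullback p (MvPolynomial (Fin n) k) M}
    (hz : z ∈ frobeniusGrading k n p 𝓜 d) (i : Λ × (Fin n → Fin p)) {e : ℤ}
    (he : ((digitExponent i.2).degree : ℤ) + p * e ≠ d) : hM.proj e (coords B z i) = 0 := by
  have mono : ∀ (a : Fin n →₀ ℕ) (c : FrobeniusCopy p k) (j : ℤ) (x : M), x ∈ 𝓜 j →
      (a.degree : ℤ) + p * j = d → hM.proj e
        (coords B (tmul p (monomial a ((FrobeniusCopy.of p k).symm c)) x) i) = 0 := by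
    intro a c
    have hc := B.mem_span c
    induction hc using Submodule.span_induction with
    | mem c hc =>
      classical
      intro j x hx hd
      obtain ⟨l, rfl⟩ := hc
      obtain ⟨q, r, rfl⟩ := exists_eq_nsmul_add_digitExponent p a
      rw [monomial_nsmul_add_digitExponent, ← tmul_smul, coords_tmul, Finsupp.single_apply]
      split_ifs with h
      · subst h
        refine hM.proj_of_mem_of_ne (hM.monomial_smul_mem q hx) fun hq => he ?_
        rw [← hd, ← hq, map_add, map_nsmul, smul_eq_mul]
        push_cast
        ring
      · exact map_zero _
    | zero =>
      intro j x _ _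
      rw [map_zero, map_zero, zero_tmul, map_zero, Finsupp.zero_apply, map_zero]
    | add c c' _ _ hc hc' =>
      intro j x hx hd
      rw [map_add, map_add, add_tmul, map_add, Finsupp.add_apply, map_add, hc j x hx hd,
        hc' j x hx hd, add_zero]
    | smul t c _ hc =>
      intro j x hx hd
      have h : (FrobeniusCopy.of p k).symm (t • c) = t ^ p * (FrobeniusCopy.of p k).symm c := rfl
      rw [h, monomial_pow_mul, ← tmul_smul]
      exact hc j _ (hM.C_smul_mem t hx) hd
  unfold frobeniusGrading at hz
  induction hz using AddSubgroup.closure_induction with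
  | zero => simp
  | add x y _ _ hx hy => rw [map_add, Finsupp.add_apply, map_add, hx, hy, add_zero]
  | neg x _ hx => rw [map_neg, Finsupp.neg_apply, map_neg, hx, neg_zero]
  | mem z hz =>
    obtain ⟨a, j, r, x, hr, hx, hd, rfl⟩ := hz
    have hsum : tmul p r x = ∑ b ∈ r.support, tmul p (monomial b (coeff b r)) x := by
      conv_lhs => rw [← support_sum_monomial_coeff r]
      exact TensorProduct.sum_tmul _ _ _
    rw [hsum, map_sum, Finsupp.finsetSum_apply, map_sum]
    refine Finset.sum_eq_zero fun b hb => ?_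
    refine mono b (FrobeniusCopy.of p k (coeff b r)) j x hx ?_
    rw [← hd, IsHomogeneous.degree_eq_sum_deg_support hr hb, Finsupp.degree_apply]

end FrobeniusBasis

/-! ### Graded `F`-modules with zero-dimensional support are coinduced -/

section FModule

variable {k : Type u} [Field k] {n : ℕ} {p : ℕ} [Fact p.Prime] [CharP k p]
  {M : Type v} [AddCommGroup M] [Module (MvPolynomial (Fin n) k) M]

variable (n p) in
/-- The exponent vector `(p - 1, …, p - 1)`. -/
def topDigits : Fin n → Fin p :=
  fun _ => ⟨p - 1, Nat.sub_lt (Fact.out : p.Prime).pos one_pos⟩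

theorem eq_topDigits {r : Fin n → Fin p} (hr : ∀ j, (r j : ℕ) + 1 = p) : r = topDigits n p := by
  funext j
  exact Fin.ext (Nat.eq_sub_of_add_eq (hr j))

theorem degree_digitExponent_topDigits :
    ((digitExponent (topDigits n p)).degree : ℤ) = n * (p - 1) := by
  have hp : 1 ≤ p := (Fact.out : p.Prime).one_le
  simp [Finsupp.degree_eq_sum, topDigits, Nat.cast_sub hp]

theorem digitExponent_add_rev (r : Fin n → Fin p) :
    digitExponent r + digitExponent (fun j => (r j).rev) = digitExponent (topDigits n p) := by
  ext j
  have := (r j).2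
  simp only [Finsupp.add_apply, digitExponent_apply, topDigits, Fin.val_rev]
  omega

theorem coords_snd_eq_topDigits_of_socle {Λ : Type*} (B : Module.Basis Λ k (FrobeniusCopy p k))
    {z : FrobeniusPullback p (MvPolynomial (Fin n) k) M}
    (hz : ∀ j, (X j : MvPolynomial (Fin n) k) • z = 0) {i : Λ × (Fin n → Fin p)}
    (hi : FrobeniusPullback.coords B z i ≠ 0) : i.2 = topDigits n p := by
  refine eq_topDigits fun j => ?_
  by_contra hj
  exact hi (FrobeniusPullback.coords_eq_zero_of_socle B hz hj)

open FrobeniusPullback in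
/-- If `y` is dual to `X ^ q` with value `m`, then `c X ^ (p - 1 - r) ⊗ y` is dual to
`X ^ (p q + r)` with value `c X ^ (p - 1) ⊗ m`. Here `y` is dual to `X ^ q` with value `m` if
`X ^ q • y = m` and every `X_j ^ (q_j + 1)` kills `y`; the exponent `p - 1 - r` is `Fin.rev r`. -/
theorem FrobeniusPullback.dual_tmul (c : k) (q : Fin n →₀ ℕ) (r : Fin n → Fin p) {y m : M}
    (hy : monomial q (1 : k) • y = m)
    (hy' : ∀ j, (X j : MvPolynomial (Fin n) k) ^ (q j + 1) • y = 0) :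
    monomial (p • q + digitExponent r) (1 : k) •
        tmul p (monomial (digitExponent fun j => (r j).rev) c) y =
      tmul p (monomial (digitExponent (topDigits n p)) c) m ∧
    ∀ j, (X j : MvPolynomial (Fin n) k) ^ ((p • q + digitExponent r) j + 1) •
        tmul p (monomial (digitExponent fun j => (r j).rev) c) y = 0 := by
  constructor
  · rw [smul_tmul, monomial_mul, add_assoc, digitExponent_add_rev, one_mul, add_comm, ← hy,
      tmul_smul, monomial_pow, monomial_mul, one_pow, mul_one]
  · intro j
    have hexp : (p • q + digitExponent r) j + 1 + (digitExponent fun j => (r j).rev) j =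
        (q j + 1) * p := by
      have := (r j).2
      simp only [Finsupp.add_apply, Finsupp.smul_apply, smul_eq_mul, digitExponent_apply,
        Fin.val_rev, add_mul, one_mul, mul_comm (q j) p]
      omega
    rw [← Finsupp.erase_add_single j (digitExponent fun j => (r j).rev), smul_tmul,
      monomial_add_single, mul_left_comm, ← pow_add, hexp, pow_mul, ← tmul_smul, hy', tmul_zero]

/-- Every socle element `s` of an `F`-module is divisible by every monomial `X ^ a`, in such a way
that the quotient is killed by all `X_j ^ (a_j + 1)`. The quotient is built from the base `p` digits
of the exponents in `a`, each application of `θ` accounting for one digit. -/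
theorem exists_dual_of_socle
    (θ : M ≃ₗ[MvPolynomial (Fin n) k] FrobeniusPullback p (MvPolynomial (Fin n) k) M) (e : ℕ) :
    ∀ a : Fin n →₀ ℕ, (∀ j, a j < p ^ e) →
      ∀ s : M, (∀ j, (X j : MvPolynomial (Fin n) k) • s = 0) →
      ∃ y : M, monomial a (1 : k) • y = s ∧
        ∀ j, (X j : MvPolynomial (Fin n) k) ^ (a j + 1) • y = 0 := by
  induction e with
  | zero =>
    intro a ha s hs
    have ha0 : a = 0 := by
      ext j
      simpa using ha j
    subst ha0
    exact ⟨s, by simp, fun j => by simpa using hs j⟩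
  | succ e ih =>
    intro a ha s hs
    obtain ⟨q, r, hqr⟩ := exists_eq_nsmul_add_digitExponent p a
    have hq : ∀ j, q j < p ^ e := by
      intro j
      refine Nat.lt_of_mul_lt_mul_left (a := p) (lt_of_le_of_lt ?_ ((ha j).trans_eq (pow_succ' p e)))
      simp [hqr]
    let B := Module.Basis.ofVectorSpace k (FrobeniusCopy p k)
    have hθs : ∀ j, (X j : MvPolynomial (Fin n) k) • θ s = 0 := fun j => by
      rw [← map_smul, hs j, map_zero]
    suffices h : ∃ y : M, monomial a (1 : k) • θ y = θ s ∧
        ∀ j, (X j : MvPolynomial (Fin n) k) ^ (a j + 1) • y = 0 by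
      obtain ⟨y, hy, hy'⟩ := h
      exact ⟨y, θ.injective (by rw [map_smul, hy]), hy'⟩
    rw [← FrobeniusPullback.sum_coords B (θ s)]
    refine Finset.sum_induction _ (fun z => ∃ y : M, monomial a (1 : k) • θ y = z ∧
      ∀ j, (X j : MvPolynomial (Fin n) k) ^ (a j + 1) • y = 0) ?_ ⟨0, by simp⟩ fun i hi => ?_
    · rintro _ _ ⟨y, rfl, hy⟩ ⟨y', rfl, hy'⟩
      exact ⟨y + y', by rw [map_add, smul_add], fun j => by rw [smul_add, hy, hy', add_zero]⟩
    · have hi_top := coords_snd_eq_topDigits_of_socle B hθs (Finsupp.mem_support_iff.1 hi)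
      obtain ⟨y, hy, hy'⟩ := ih q hq _ (FrobeniusPullback.X_smul_coords_of_socle B hθs i)
      obtain ⟨h1, h2⟩ :=
        FrobeniusPullback.dual_tmul ((FrobeniusCopy.of p k).symm (B i.1)) q r hy hy'
      refine ⟨θ.symm (FrobeniusPullback.tmul p (monomial (digitExponent fun j => (r j).rev)
        ((FrobeniusCopy.of p k).symm (B i.1))) y), ?_, fun j => ?_⟩
      · rw [θ.apply_symm_apply, hqr, h1, ← hi_top]
        rfl
      · rw [hqr, ← map_smul, h2, map_zero]

variable {𝓜 : ℤ → AddSubgroup M}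

/-- If the socle of `M` is nonzero in degree `d`, then it is nonzero in a degree `e` with
`d + n = p (e + n)`; this descent can only stop at `d = -n`. -/
theorem IsGradedFModule.degree_eq_of_socle
    {θ : M ≃ₗ[MvPolynomial (Fin n) k] FrobeniusPullback p (MvPolynomial (Fin n) k) M}
    (hM : IsGradedFModule k n p 𝓜 θ) {d : ℤ} {s : M} (hsd : s ∈ 𝓜 d) (hs0 : s ≠ 0)
    (hs : ∀ j, (X j : MvPolynomial (Fin n) k) • s = 0) : d = -n := by
  induction h : (d + n).natAbs using Nat.strong_induction_on generalizing d s with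
  | _ N ih =>
    have hG := hM.isGradedModule
    have hp : 2 ≤ p := (Fact.out : p.Prime).two_le
    let B := Module.Basis.ofVectorSpace k (FrobeniusCopy p k)
    have hθs : ∀ j, (X j : MvPolynomial (Fin n) k) • θ s = 0 := fun j => by
      rw [← map_smul, hs j, map_zero]
    have hcoords : FrobeniusPullback.coords B (θ s) ≠ 0 := by simpa using hs0
    obtain ⟨i, hi⟩ := Finsupp.ne_iff.1 hcoords
    obtain ⟨e, he⟩ : ∃ e, hG.proj e (FrobeniusPullback.coords B (θ s) i) ≠ 0 := by
      by_contra! hall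
      exact hi (hG.eq_zero_of_proj hall)
    have hde : ((digitExponent i.2).degree : ℤ) + p * e = d := by
      by_contra hne
      exact he (FrobeniusPullback.proj_coords_eq_zero B hG (hM.isDegreePreserving d s hsd) i hne)
    rw [coords_snd_eq_topDigits_of_socle B hθs hi, degree_digitExponent_topDigits] at hde
    have hdn : d + n = p * (e + n) := by rw [← hde]; ring
    by_contra hne
    have hlt : (e + n).natAbs < N := by
      have hpos : 0 < (e + n : ℤ).natAbs := by
        refine Int.natAbs_pos.2 fun h0 => hne ?_
        rw [h0, mul_zero] at hdn
        omega
      rw [← h, hdn, Int.natAbs_mul, Int.natAbs_natCast]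
      nlinarith
    have he_eq := ih _ hlt (hG.proj_mem e _) he (fun j => by
      rw [← hG.proj_smul (isHomogeneous_X k j), FrobeniusPullback.X_smul_coords_of_socle B hθs,
        map_zero]) rfl
    rw [he_eq] at hdn
    exact hne (by linarith)

theorem IsGradedFModule.isCoinduced
    {θ : M ≃ₗ[MvPolynomial (Fin n) k] FrobeniusPullback p (MvPolynomial (Fin n) k) M}
    (hM : IsGradedFModule k n p 𝓜 θ)
    (hdim : Module.supportDim (MvPolynomial (Fin n) k) M ≤ 0) : IsCoinduced k n 𝓜 (-n) := by
  have hG := hM.isGradedModule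
  have top : ∀ d x, x ∈ 𝓜 d → x ≠ 0 →
      ∃ a : Fin n →₀ ℕ, (a.degree : ℤ) + d = -n ∧ monomial a (1 : k) • x ≠ 0 := by
    intro d x hx hx0
    obtain ⟨a, ha, ha'⟩ :=
      exists_monomial_smul_ne_zero hx0 (hG.exists_X_pow_smul_eq_zero hdim hx)
    exact ⟨a, hM.degree_eq_of_socle (hG.monomial_smul_mem a hx) ha ha', ha⟩
  refine ⟨fun d x hx h => ?_, fun a s hs => ?_⟩
  · by_contra hx0
    obtain ⟨a, had, ha⟩ := top d x hx hx0
    exact ha (h a had)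
  · have hs_socle : ∀ j, (X j : MvPolynomial (Fin n) k) • s = 0 := by
      intro j
      by_contra hne
      obtain ⟨b, hb, -⟩ := top _ _ (hG.smul_mem 1 _ _ s (isHomogeneous_X k j) hs) hne
      omega
    obtain ⟨y, hy, hy'⟩ := exists_dual_of_socle θ a.degree a (fun j =>
      (Finsupp.le_degree j a).trans_lt (Nat.lt_pow_self (Fact.out : p.Prime).one_lt)) s hs_socle
    refine ⟨hG.proj (-n - a.degree) y, hG.proj_mem _ y, ?_, fun b hb hba => ?_⟩
    · rw [← hG.proj_smul (isHomogeneous_monomial (1 : k) rfl), add_sub_cancel, hy,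
        hG.proj_of_mem hs]
    · obtain ⟨j, hj⟩ : ∃ j, a j < b j := by
        by_contra! hle
        obtain ⟨c, rfl⟩ := exists_add_of_le (show b ≤ a from hle)
        rw [map_add, left_eq_add, Finsupp.degree_eq_zero_iff] at hb
        exact hba (by rw [hb, add_zero])
      refine monomial_smul_eq_zero_of_le (N := a j + 1) hj ?_
      rw [← hG.proj_smul (by simpa using (isHomogeneous_X k j).pow (a j + 1)), hy', map_zero]

end FModule

theorem theorem2p3 {k : Type u} [Field k] (p : ℕ) [Fact p.Prime] [CharP k p] (n : ℕ)
    {M : Type v} [AddCommGroup M] [Module (MvPolynomial (Fin n) k) M]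
    (𝓜 : ℤ → AddSubgroup M)
    (θ : M ≃ₗ[MvPolynomial (Fin n) k] FrobeniusPullback p (MvPolynomial (Fin n) k) M)
    (hM : IsGradedFModule k n p 𝓜 θ)
    (hdim : Module.supportDim (MvPolynomial (Fin n) k) M ≤ 0) :
    IsStarInjective.{u, v, w} k n 𝓜 ∧
      ∃ (ι : Type v) (N : ι → Submodule (MvPolynomial (Fin n) k) M),
        iSupIndep N ∧ iSup N = ⊤ ∧
        ∀ i, IsGradedSubmodule k n 𝓜 (N i) ∧
          ∃ t : ℤ, IsStarEShift.{u, v, w} k n (inducedGrading k n 𝓜 (N i)) t := by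
  have h := hM.isCoinduced hdim
  obtain ⟨ι, N, h_indep, h_top, hN⟩ := h.exists_decomposition hM.isGradedModule
  exact ⟨h.isStarInjective hM.isGradedModule, ι, N, h_indep, h_top,
    fun i => ⟨(hN i).1, _, (hN i).2⟩⟩
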